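/- Let $m\ge 1$ and let $S(z)=\sum_{n=-N}^{N}C_nz^n$, $C_n\in\mathbb{C}^{m\times m}$, $C_N\neq 0$, be an $m\times m$ Laurent polynomial matrix function of degree $N$ which is positive definite almost everywhere on the unit circle $\mathbb{T}=\{z\in\mathbb{C}:|z|=1\}$. Suppose that $\det S$ has only simple roots in $\mathbb{C}\setminus\{0\}$, and that $\det S(z)=\sum_{n=-L}^{L}c_nz^n$ is a Laurent polynomial of degree $L$, i.e. $c_L\neq 0$. A polynomial spectral factor of $S$ is a polynomial matrix $P(z)=\sum_{n=0}^{N}B_nz^n$, $B_n\in\mathbb{C}^{m\times m}$, with $S(z)=P(z)\widetilde P(z)$ for $z\in\mathbb{C}\setminus\{0\}$, where $\widetilde P(z)=\sum_{n=0}^{N}B_n^*z^{-n}$. A scalar spectral factor of $\det S$ is a polynomial $p(z)=\sum_{n=0}^{L}b_nz^n$, $b_n\in\mathbb{C}$, with $\det S(z)=p(z)\widetilde p(z)$, where $\widetilde p(z)=\sum_{n=0}^{L}\overline{b_n}z^{-n}$. Two spectral factors $P_1,P_2$ of $S$ are identified if $P_2=P_1U$ for a constant unitary matrix $U$. Then $S$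 has exactly $2^L$ polynomial spectral factors $P$ whose determinant $\det P$ is a scalar spectral factor of $\det S$. In particular, if $\det S$ has the full degree $L=mN$ (equivalently, $C_N$ is nonsingular), then $S$ has exactly $2^L$ polynomial spectral factors. -/

import Mathlib

open MeasureTheory
open scoped ComplexOrder Matrix

noncomputable section

namespace SpectralFactor

/-- The adjoint `f̃(z) = conj (f (1 / conj z))` of a scalar Laurent polynomial: the coefficients are
conjugated and `z` is replaced by `z⁻¹`. -/
def adj : LaurentPolynomial ℂ →+* LaurentPolynomial ℂ :=
  (LaurentPolynomial.invert : LaurentPolynomial ℂ ≃ₐ[ℂ] LaurentPolynomial ℂ).toRingEquiv.toRingHom.comp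
    (AddMonoidAlgebra.mapRingHom ℤ (starRingEnd ℂ))

theorem coeff_adj (f : LaurentPolynomial ℂ) (n : ℤ) :
    (adj f).coeff n = star (f.coeff (-n)) := by
  simp [adj]

/-- The adjoint `P̃` of a polynomial matrix `P(z) = ∑ Bₙ zⁿ`, i.e. `P̃(z) = ∑ Bₙᴴ z⁻ⁿ`. -/
def matrixAdj {m : ℕ} (P : Matrix (Fin m) (Fin m) (Polynomial ℂ)) :
    Matrix (Fin m) (Fin m) (LaurentPolynomial ℂ) :=
  ((P.map Polynomial.toLaurent)ᵀ).map adj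

/-- The value `S(z)` of a Laurent polynomial matrix at a nonzero complex number `z`. -/
def evalAt {m : ℕ} (S : Matrix (Fin m) (Fin m) (LaurentPolynomial ℂ)) (z : ℂˣ) :
    Matrix (Fin m) (Fin m) ℂ :=
  S.map (LaurentPolynomial.eval₂ (RingHom.id ℂ) z)

/-- The matrix coefficient `Cₙ` of a Laurent polynomial matrix `S(z) = ∑ Cₙ zⁿ`. -/
def coeffMatrix {m : ℕ} (S : Matrix (Fin m) (Fin m) (LaurentPolynomial ℂ)) (n : ℤ) :
    Matrix (Fin m) (Fin m) ℂ :=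
  Matrix.of fun i j => (S i j).coeff n

/-- `S(z) = ∑_{n=-N}^{N} Cₙ zⁿ` with `C_N ≠ 0`. -/
def HasMatrixDegree {m : ℕ} (S : Matrix (Fin m) (Fin m) (LaurentPolynomial ℂ)) (N : ℕ) : Prop :=
  (∀ n : ℤ, (N : ℤ) < |n| → coeffMatrix S n = 0) ∧ coeffMatrix S N ≠ 0

/-- `f(z) = ∑_{n=-L}^{L} cₙ zⁿ` with `c_L ≠ 0`. -/
def HasDegree (f : LaurentPolynomial ℂ) (L : ℕ) : Prop :=
  (∀ n : ℤ, (L : ℤ) < |n| → f.coeff n = 0) ∧ f.coeff L ≠ 0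

/-- `S` is positive definite almost everywhere on the unit circle. -/
def PosDefAE {m : ℕ} (S : Matrix (Fin m) (Fin m) (LaurentPolynomial ℂ)) : Prop :=
  ∀ᵐ θ : ℝ, (evalAt S (Circle.toUnits (Circle.exp θ))).PosDef

/-- Every root of `f` in `ℂ ∖ {0}` is simple: `(z - a)²` divides `f` for no `a ≠ 0`. -/
def HasOnlySimpleRoots (f : LaurentPolynomial ℂ) : Prop :=
  ∀ a : ℂ, a ≠ 0 → ¬ (LaurentPolynomial.T 1 - LaurentPolynomial.C a) ^ 2 ∣ f

/-- `P(z) = ∑_{n=0}^{N} Bₙ zⁿ` is a (possibly non-optimal) polynomial spectral factor of `S`: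
`S = P P̃`. -/
structure IsSpectralFactor {m : ℕ} (S : Matrix (Fin m) (Fin m) (LaurentPolynomial ℂ)) (N : ℕ)
    (P : Matrix (Fin m) (Fin m) (Polynomial ℂ)) : Prop where
  natDegree_le : ∀ i j, (P i j).natDegree ≤ N
  mul_adj : P.map Polynomial.toLaurent * matrixAdj P = S

/-- `p(z) = ∑_{n=0}^{L} bₙ zⁿ` is a (possibly non-optimal) scalar spectral factor of `f`:
`f = p p̃`. -/
structure IsScalarSpectralFactor (f : LaurentPolynomial ℂ) (L : ℕ) (p : Polynomial ℂ) : Prop where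
  natDegree_le : p.natDegree ≤ L
  mul_adj : Polynomial.toLaurent p * adj (Polynomial.toLaurent p) = f

/-- Two polynomial matrices are identified if they differ by a constant unitary right multiplier. -/
def unitarySetoid (m : ℕ) : Setoid (Matrix (Fin m) (Fin m) (Polynomial ℂ)) where
  r P Q := ∃ U ∈ Matrix.unitaryGroup (Fin m) ℂ, Q = P * U.map Polynomial.C
  iseqv :=
    { refl := fun P => ⟨1, one_mem _, by simp⟩
      symm := by
        rintro P Q ⟨U, hU, rfl⟩
        refine ⟨star U, Unitary.star_mem hU, ?_⟩
        rw [Matrix.mul_assoc, ← Matrix.map_mul, Matrix.mem_unitaryGroup_iff.mp hU]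
        simp
      trans := by
        rintro P Q R ⟨U, hU, rfl⟩ ⟨V, hV, rfl⟩
        exact ⟨U * V, mul_mem hU hV, by rw [Matrix.mul_assoc, ← Matrix.map_mul]⟩ }

/-- The number of elements of a set of polynomial matrices, counted up to constant unitary right
multipliers. -/
def countUpToUnitary {m : ℕ} (A : Set (Matrix (Fin m) (Fin m) (Polynomial ℂ))) : ℕ∞ :=
  ((Quotient.mk (unitarySetoid m)) '' A).encard

end SpectralFactor

end

noncomputable section

namespace SpectralFactor

/-! Write `gram P` for P P̃. Then det S = p p̃ with p = det P, and the coefficient of z^(-L) is p(0)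
times the conjugate of the L-th coefficient of p. Hence p is a scalar spectral factor exactly when
p(0) ≠ 0, and the degree bounds on P and p follow (`isSpectralFactor_and_iff`). It remains to count
the solutions of `gram P = S` with det P(0) ≠ 0, up to unitaries.

The basic move is a flip (`exists_flip`). If det P(a) = 0, some unitary U makes a column of P(a)U
vanish; replacing the factor z - a of that column of PU by 1 - conj(a) z preserves `gram` and moves
the zero a of the determinant to 1/conj a.

Existence is a matrix Fejér–Riesz theorem. Elimination by Schur complements, with scalar Fejér–Riesz
for the pivots, gives A Ã = d d̃ S (`exists_rational_factor`); flips then allow the roots of d to be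
divided out one at a time (`exists_gram_eq`).

Now fix one solution P₀. Its determinant has L distinct zeros, and simplicity of the roots of det S
forbids a and 1/conj a from both being zeros. Encode a solution P by the set of zeros of det P₀ that
are also zeros of det P. Flips realize every subset (`exists_rootsIn_eq`). Two solutions with the
same code differ by a polynomial matrix with polynomial inverse that is unitary on the circle, hence
constant (`exists_unitary_of_roots`). This gives 2^L classes. -/

/-! ### Adjoints, evaluation and reflection in the unit circle -/

open LaurentPolynomial (T) in
@[simp] theorem adj_T (n : ℤ) : adj (T n) = T (-n) := by
  ext k
  rw [coeff_adj]
  simp only [LaurentPolynomial.T_apply]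
  by_cases h : n = -k
  · simp [h]
  · have h' : -n ≠ k := fun h' => h (by omega)
    simp [h, h']

@[simp] theorem adj_C (a : ℂ) : adj (LaurentPolynomial.C a) = LaurentPolynomial.C (star a) := by
  ext k
  rw [coeff_adj]
  simp only [LaurentPolynomial.C_apply, neg_eq_zero]
  split_ifs <;> simp

@[simp] theorem adj_adj (f : LaurentPolynomial ℂ) : adj (adj f) = f := by
  ext k
  simp [coeff_adj]

theorem adj_injective : Function.Injective adj :=
  Function.LeftInverse.injective adj_adj

/-- Evaluation of a Laurent polynomial at a unit. -/
abbrev ev (z : ℂˣ) : LaurentPolynomial ℂ →+* ℂ := LaurentPolynomial.eval₂ (RingHom.id ℂ) z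

theorem ev_toLaurent (z : ℂˣ) (p : Polynomial ℂ) : ev z p.toLaurent = p.eval (z : ℂ) := by
  simp [ev, Polynomial.eval₂_eq_eval_map]

/-- The reflection `z ↦ 1 / conj z` of the punctured plane in the unit circle. -/
def refl (z : ℂˣ) : ℂˣ := (star z)⁻¹

@[simp] theorem refl_refl (z : ℂˣ) : refl (refl z) = z := by
  ext; simp [refl]

theorem refl_coe (z : ℂˣ) : ((refl z : ℂˣ) : ℂ) = (star (z : ℂ))⁻¹ := by
  simp [refl]

theorem ev_adj (z : ℂˣ) (f : LaurentPolynomial ℂ) : ev z (adj f) = star (ev (refl z) f) := by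
  induction f using LaurentPolynomial.induction_on' with
  | add p q hp hq => simp only [map_add, star_add, hp, hq]
  | C_mul_T n a =>
    simp [refl, map_mul]

/-! ### Extreme coefficients of p p̃ -/

theorem coeff_toLaurent_natCast (p : Polynomial ℂ) (n : ℕ) :
    p.toLaurent.coeff (n : ℤ) = p.coeff n := by
  induction p using Polynomial.induction_on' with
  | add p q hp hq => simp only [map_add, AddMonoidAlgebra.coeff_add, Finsupp.add_apply, hp, hq, Polynomial.coeff_add]
  | monomial k a =>
    rw [Polynomial.toLaurent_C_mul_T, ← LaurentPolynomial.single_eq_C_mul_T, Polynomial.coeff_monomial,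
      AddMonoidAlgebra.coeff_single, Finsupp.single_apply]
    simp

theorem coeff_toLaurent_of_neg (p : Polynomial ℂ) {n : ℤ} (hn : n < 0) :
    p.toLaurent.coeff n = 0 := by
  induction p using Polynomial.induction_on' with
  | add p q hp hq => simp only [map_add, AddMonoidAlgebra.coeff_add, Finsupp.add_apply, hp, hq, add_zero]
  | monomial k a =>
    rw [Polynomial.toLaurent_C_mul_T, ← LaurentPolynomial.single_eq_C_mul_T,
      AddMonoidAlgebra.coeff_single, Finsupp.single_apply, if_neg (by omega)]

theorem coeff_mul_T (f : LaurentPolynomial ℂ) (n k : ℤ) :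
    (f * LaurentPolynomial.T n).coeff k = f.coeff (k - n) := by
  induction f using LaurentPolynomial.induction_on' with
  | add p q hp hq => simp [add_mul, hp, hq]
  | C_mul_T j a =>
    rw [mul_assoc, ← LaurentPolynomial.T_add, ← LaurentPolynomial.single_eq_C_mul_T,
      ← LaurentPolynomial.single_eq_C_mul_T]
    simp only [AddMonoidAlgebra.coeff_single, Finsupp.single_apply]
    congr 1
    exact propext ⟨fun h => by omega, fun h => by omega⟩

theorem exists_toLaurent_eq_adj_mul_T (q : Polynomial ℂ) {D : ℕ} (hq : q.natDegree ≤ D) :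
    ∃ r : Polynomial ℂ, r.toLaurent = adj q.toLaurent * LaurentPolynomial.T D ∧
      r.coeff 0 = star (q.coeff D) := by
  have h : ∃ r : Polynomial ℂ, r.toLaurent = adj q.toLaurent * LaurentPolynomial.T D := by
    refine ⟨∑ k ∈ Finset.range (D + 1), Polynomial.C (star (q.coeff k)) * Polynomial.X ^ (D - k), ?_⟩
    conv_rhs => rw [q.as_sum_range_C_mul_X_pow' (Nat.lt_succ_of_le hq)]
    simp only [map_sum, Finset.sum_mul]
    refine Finset.sum_congr rfl fun k hk => ?_
    have hk' : k ≤ D := by simpa [Nat.lt_succ_iff] using hk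
    rw [map_mul, map_mul, map_mul, Polynomial.toLaurent_C, Polynomial.toLaurent_C,
      Polynomial.toLaurent_X_pow, Polynomial.toLaurent_X_pow, adj_C, adj_T, mul_assoc,
      ← LaurentPolynomial.T_add]
    congr 2
    omega
  obtain ⟨r, hr⟩ := h
  refine ⟨r, hr, ?_⟩
  rw [← coeff_toLaurent_natCast, hr, coeff_mul_T, coeff_adj, Nat.cast_zero, zero_sub, neg_neg,
    coeff_toLaurent_natCast]

/-- The lowest coefficient of `p q̃`. -/
theorem coeff_toLaurent_mul_adj (p q : Polynomial ℂ) {D : ℕ} (hq : q.natDegree ≤ D) :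
    (p.toLaurent * adj q.toLaurent).coeff (-(D : ℤ)) = p.coeff 0 * star (q.coeff D) := by
  obtain ⟨r, hr, hr0⟩ := exists_toLaurent_eq_adj_mul_T q hq
  have : p.toLaurent * adj q.toLaurent * LaurentPolynomial.T D = (p * r).toLaurent := by
    rw [map_mul, hr, mul_assoc]
  have h := coeff_mul_T (p.toLaurent * adj q.toLaurent) D 0
  rw [this, zero_sub] at h
  rw [← h, ← Nat.cast_zero (R := ℤ), coeff_toLaurent_natCast, Polynomial.mul_coeff_zero, hr0]

theorem toLaurent_mul_adj_self_coeff_neg (p : Polynomial ℂ) (n : ℤ) :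
    (p.toLaurent * adj p.toLaurent).coeff (-n) = star ((p.toLaurent * adj p.toLaurent).coeff n) := by
  have h : adj (p.toLaurent * adj p.toLaurent) = p.toLaurent * adj p.toLaurent := by
    rw [map_mul, adj_adj, mul_comm]
  conv_lhs => rw [← h]
  rw [coeff_adj, neg_neg]

theorem coeff_zero_mul_coeff_ne_zero {f : LaurentPolynomial ℂ} {L : ℕ} (hf : HasDegree f L)
    {p : Polynomial ℂ} (hp : p.toLaurent * adj p.toLaurent = f) (hd : p.natDegree ≤ L) :
    p.coeff 0 ≠ 0 ∧ p.coeff L ≠ 0 := by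
  have h := coeff_toLaurent_mul_adj p p hd
  rw [toLaurent_mul_adj_self_coeff_neg, hp] at h
  have h2 : p.coeff 0 * star (p.coeff L) ≠ 0 := by
    rw [← h]
    exact star_ne_zero.mpr hf.2
  exact ⟨left_ne_zero_of_mul h2, star_ne_zero.mp (right_ne_zero_of_mul h2)⟩

/-- With D the degree of p, the coefficient of z^(-D) in p p̃ is p(0) times the conjugate leading
coefficient; it is nonzero, so D cannot exceed L. -/
theorem natDegree_le_of_coeff_zero_ne_zero {f : LaurentPolynomial ℂ} {L : ℕ} (hf : HasDegree f L)
    {p : Polynomial ℂ} (hp : p.toLaurent * adj p.toLaurent = f) (h0 : p.coeff 0 ≠ 0) :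
    p.natDegree ≤ L := by
  by_contra! hlt
  have h := coeff_toLaurent_mul_adj p p le_rfl
  rw [hp, hf.1 _ (by rw [abs_neg, Nat.abs_cast]; exact_mod_cast hlt)] at h
  have hp0 : p ≠ 0 := by
    rintro rfl
    simp at h0
  exact mul_ne_zero h0 (star_ne_zero.mpr (Polynomial.leadingCoeff_ne_zero.mpr hp0)) h.symm

/-! ### Zeros of p when p p̃ has simple roots -/

/-- `(z - a) (1/z - conj a)`, which is `|z - a|²` on the unit circle. -/
theorem toLaurent_X_sub_C_mul_adj (a : ℂ) :
    (Polynomial.X - Polynomial.C a).toLaurent * adj (Polynomial.X - Polynomial.C a).toLaurent =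
      (1 - Polynomial.C (star a) * Polynomial.X).toLaurent *
        adj (1 - Polynomial.C (star a) * Polynomial.X).toLaurent := by
  have h : (LaurentPolynomial.T 1 : LaurentPolynomial ℂ) * LaurentPolynomial.T (-1) = 1 := by
    rw [← LaurentPolynomial.T_add]; simp
  simp only [map_sub, map_mul, map_one, Polynomial.toLaurent_X, Polynomial.toLaurent_C, adj_T, adj_C,
    star_star]
  linear_combination (1 - LaurentPolynomial.C a * LaurentPolynomial.C (star a)) * h

theorem adj_X_sub_C (a : ℂ) : adj (Polynomial.X - Polynomial.C a).toLaurent =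
    LaurentPolynomial.T (-1) * (1 - Polynomial.C (star a) * Polynomial.X).toLaurent := by
  have h : (LaurentPolynomial.T 1 : LaurentPolynomial ℂ) * LaurentPolynomial.T (-1) = 1 := by
    rw [← LaurentPolynomial.T_add]; simp
  simp only [map_sub, map_mul, map_one, Polynomial.toLaurent_X, Polynomial.toLaurent_C, adj_T, adj_C]
  linear_combination LaurentPolynomial.C (star a) * h

/-- A zero of p at 1/conj a makes z - a divide p̃, so together with a zero of p at a it gives a
double root of f. In particular p has no zero on the circle. -/
theorem eval_refl_ne_zero {f : LaurentPolynomial ℂ} (hf : HasOnlySimpleRoots f) {p : Polynomial ℂ}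
    (hp : p.toLaurent * adj p.toLaurent = f) (a : ℂˣ) (ha : p.eval (a : ℂ) = 0) :
    p.eval (refl a : ℂ) ≠ 0 := by
  intro hb
  obtain ⟨q, rfl⟩ := Polynomial.dvd_iff_isRoot.mpr ha
  obtain ⟨r, hr⟩ := Polynomial.dvd_iff_isRoot.mpr hb
  refine hf a a.ne_zero ?_
  have e : (LaurentPolynomial.T 1 - LaurentPolynomial.C (a : ℂ)) =
    (Polynomial.X - Polynomial.C (a : ℂ)).toLaurent := by simp
  have key : (Polynomial.X - Polynomial.C (a : ℂ)).toLaurent ∣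
      adj ((Polynomial.X - Polynomial.C (a : ℂ)) * q).toLaurent := by
    rw [hr, map_mul, map_mul, adj_X_sub_C]
    refine Dvd.dvd.mul_right (Dvd.dvd.mul_left ?_ _) _
    -- The conjugate of `refl a` is 1/a, and 1 - z/a = -(1/a)(z - a).
    refine ⟨LaurentPolynomial.C (-(star (refl a : ℂ))), ?_⟩
    have h1 : LaurentPolynomial.C (star (refl a : ℂ)) * LaurentPolynomial.C (a : ℂ) = 1 := by
      rw [← map_mul]; simp [refl_coe]
    simp only [map_sub, map_mul, map_one, map_neg, Polynomial.toLaurent_X, Polynomial.toLaurent_C]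
    linear_combination -h1
  rw [← hp, sq, e]
  refine mul_dvd_mul ?_ key
  rw [map_mul]
  exact dvd_mul_right _ _

theorem roots_nodup {f : LaurentPolynomial ℂ} (hf : HasOnlySimpleRoots f) {p : Polynomial ℂ}
    (hp : p.toLaurent * adj p.toLaurent = f) (h0 : p.coeff 0 ≠ 0) : p.roots.Nodup := by
  rw [Multiset.nodup_iff_count_le_one]
  intro a
  by_contra! hlt
  rw [Polynomial.count_roots] at hlt
  have hd : (Polynomial.X - Polynomial.C a) ^ 2 ∣ p :=
    (pow_dvd_pow _ hlt).trans (Polynomial.pow_rootMultiplicity_dvd p a)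
  have ha : a ≠ 0 := by
    rintro rfl
    apply h0
    obtain ⟨q, rfl⟩ := hd
    simp [Polynomial.mul_coeff_zero, sq]
  refine hf a ha ?_
  have e : (LaurentPolynomial.T 1 - LaurentPolynomial.C (a : ℂ)) =
    (Polynomial.X - Polynomial.C (a : ℂ)).toLaurent := by simp
  rw [← hp, e, ← map_pow]
  exact (map_dvd Polynomial.toLaurent hd).mul_right _

/-! ### Gram matrices and their determinants -/

variable {m : ℕ}

/-- The product `P P̃`. -/
def gram (P : Matrix (Fin m) (Fin m) (Polynomial ℂ)) :
    Matrix (Fin m) (Fin m) (LaurentPolynomial ℂ) :=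
  P.map Polynomial.toLaurent * matrixAdj P

theorem gram_apply (P : Matrix (Fin m) (Fin m) (Polynomial ℂ)) (i k : Fin m) :
    gram P i k = ∑ j, (P i j).toLaurent * adj (P k j).toLaurent := by
  simp [gram, matrixAdj, Matrix.mul_apply]

theorem matrixAdj_mul (P Q : Matrix (Fin m) (Fin m) (Polynomial ℂ)) :
    matrixAdj (P * Q) = matrixAdj Q * matrixAdj P := by
  simp only [matrixAdj]
  rw [Matrix.map_mul, Matrix.transpose_mul, Matrix.map_mul]

theorem det_map_toLaurent (P : Matrix (Fin m) (Fin m) (Polynomial ℂ)) :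
    (P.map Polynomial.toLaurent).det = P.det.toLaurent := by
  rw [RingHom.map_det, RingHom.mapMatrix_apply]

theorem det_matrixAdj (P : Matrix (Fin m) (Fin m) (Polynomial ℂ)) :
    (matrixAdj P).det = adj P.det.toLaurent := by
  rw [matrixAdj, ← RingHom.mapMatrix_apply, ← RingHom.map_det, Matrix.det_transpose,
    det_map_toLaurent]

theorem det_gram (P : Matrix (Fin m) (Fin m) (Polynomial ℂ)) :
    (gram P).det = P.det.toLaurent * adj P.det.toLaurent := by
  rw [gram, Matrix.det_mul, det_map_toLaurent, det_matrixAdj]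

theorem matrixAdj_map_C (U : Matrix (Fin m) (Fin m) ℂ) :
    matrixAdj (U.map Polynomial.C) = (Uᴴ).map LaurentPolynomial.C := by
  ext1 i j
  simp [matrixAdj]

theorem gram_mul_unitary (P : Matrix (Fin m) (Fin m) (Polynomial ℂ)) {U : Matrix (Fin m) (Fin m) ℂ}
    (hU : U ∈ Matrix.unitaryGroup (Fin m) ℂ) : gram (P * U.map Polynomial.C) = gram P := by
  have h : (U.map Polynomial.C).map Polynomial.toLaurent = U.map LaurentPolynomial.C := by
    ext1 i j; simp
  rw [gram, matrixAdj_mul, matrixAdj_map_C, Matrix.map_mul, h, Matrix.mul_assoc,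
    ← Matrix.mul_assoc (U.map _), ← Matrix.map_mul]
  have := Matrix.mem_unitaryGroup_iff.mp hU
  rw [Matrix.star_eq_conjTranspose] at this
  rw [this]
  simp [gram]

theorem det_mul_map_C (P : Matrix (Fin m) (Fin m) (Polynomial ℂ)) (U : Matrix (Fin m) (Fin m) ℂ) :
    (P * U.map Polynomial.C).det = P.det * Polynomial.C U.det := by
  rw [Matrix.det_mul, RingHom.map_det, RingHom.mapMatrix_apply]

theorem det_ne_zero_of_mem_unitaryGroup {U : Matrix (Fin m) (Fin m) ℂ}
    (hU : U ∈ Matrix.unitaryGroup (Fin m) ℂ) : U.det ≠ 0 := by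
  intro h
  have := congrArg Matrix.det (Matrix.mem_unitaryGroup_iff.mp hU)
  rw [Matrix.det_mul, h] at this
  simp at this

theorem eval_det (P : Matrix (Fin m) (Fin m) (Polynomial ℂ)) (a : ℂ) :
    P.det.eval a = (P.map (Polynomial.eval a)).det := by
  have := RingHom.map_det (Polynomial.evalRingHom a) P
  simpa using this

/-! ### Blaschke–Potapov flips -/

/-- A singular matrix has a zero column in a suitable orthonormal basis. -/
theorem exists_unitary_col_eq_zero (M : Matrix (Fin m) (Fin m) ℂ) (hM : M.det = 0) :
    ∃ U ∈ Matrix.unitaryGroup (Fin m) ℂ, ∃ j, ∀ i, (M * U) i j = 0 := by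
  have hH : (Mᴴ * M).IsHermitian := Matrix.isHermitian_conjTranspose_mul_self M
  have hdet : (Mᴴ * M).det = 0 := by rw [Matrix.det_mul, hM, mul_zero]
  rw [hH.det_eq_prod_eigenvalues, Finset.prod_eq_zero_iff] at hdet
  obtain ⟨j, -, hj⟩ := hdet
  have hj' : hH.eigenvalues j = 0 := by simpa using hj
  have h := hH.mulVec_eigenvectorBasis j
  rw [hj', zero_smul, Matrix.conjTranspose_mul_self_mulVec_eq_zero] at h
  refine ⟨hH.eigenvectorUnitary, hH.eigenvectorUnitary.2, j, fun i => ?_⟩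
  have := congrFun h i
  simpa [Matrix.mul_apply, Matrix.mulVec, dotProduct] using this

/-- Multiplication by a Blaschke–Potapov factor moves a zero `a` of `det P` to `1 / conj a`. -/
theorem exists_flip (P : Matrix (Fin m) (Fin m) (Polynomial ℂ)) (a : ℂ) (ha : P.det.eval a = 0) :
    ∃ Q : Matrix (Fin m) (Fin m) (Polynomial ℂ), ∃ c : ℂ, c ≠ 0 ∧ gram Q = gram P ∧
      Q.det * (Polynomial.X - Polynomial.C a) =
        Polynomial.C c * P.det * (1 - Polynomial.C (star a) * Polynomial.X) := by
  rw [eval_det] at ha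
  obtain ⟨U, hU, j, hj⟩ := exists_unitary_col_eq_zero _ ha
  have hdvd : ∀ i, (Polynomial.X - Polynomial.C a) ∣ (P * U.map Polynomial.C) i j := by
    intro i
    rw [Polynomial.dvd_iff_isRoot, Polynomial.IsRoot, ← hj i, Matrix.mul_apply, Matrix.mul_apply,
      Polynomial.eval_finsetSum]
    simp
  choose w hw using hdvd
  set R := P * U.map Polynomial.C with hR
  have hRw : R = R.updateCol j ((Polynomial.X - Polynomial.C a) • w) := by
    rw [← Matrix.updateCol_eq_self R j]
    simp only [Matrix.updateCol_idem]
    congr 1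
    ext1 i
    simp [hw]
  -- The new column factor has the same product with its adjoint as z - a, so each column's
  -- contribution to the Gram matrix is unchanged.
  refine ⟨R.updateCol j ((1 - Polynomial.C (star a) * Polynomial.X) • w), U.det,
    det_ne_zero_of_mem_unitaryGroup hU, ?_, ?_⟩
  · rw [← gram_mul_unitary P hU, ← hR]
    ext1 i k
    rw [gram_apply, gram_apply]
    refine Finset.sum_congr rfl fun l _ => ?_
    by_cases hl : l = j
    · subst hl
      simp only [Matrix.updateCol_self, Pi.smul_apply, smul_eq_mul, hw, map_mul _ _ (w _), map_mul adj]
      linear_combination -((w i).toLaurent * adj (w k).toLaurent) * toLaurent_X_sub_C_mul_adj a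
    · simp [Matrix.updateCol_ne hl]
  · have hd : R.det = (Polynomial.X - Polynomial.C a) * (R.updateCol j w).det := by
      conv_lhs => rw [hRw]
      rw [Matrix.det_updateCol_smul]
    rw [hR, det_mul_map_C, ← hR] at hd
    rw [Matrix.det_updateCol_smul]
    linear_combination (-(1 - Polynomial.C (star a) * Polynomial.X)) * hd

/-- The zeros of `det P` at a point off the unit circle can be moved away. -/
theorem exists_eval_det_ne_zero (b : ℂ) (hb : 1 - star b * b ≠ 0)
    (P : Matrix (Fin m) (Fin m) (Polynomial ℂ)) (hP : P.det ≠ 0) :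
    ∃ Q : Matrix (Fin m) (Fin m) (Polynomial ℂ), gram Q = gram P ∧ Q.det.eval b ≠ 0 := by
  induction hk : P.det.rootMultiplicity b generalizing P with
  | zero =>
    refine ⟨P, rfl, fun h => ?_⟩
    have := (Polynomial.rootMultiplicity_pos hP).mpr h
    omega
  | succ k ih =>
    have hroot : P.det.eval b = 0 :=
      (Polynomial.rootMultiplicity_pos hP).mp (by omega)
    obtain ⟨Q, c, hc, hQ, hdet⟩ := exists_flip P b hroot
    -- The factor introduced by the flip does not vanish at b, so the multiplicity of b drops by
    -- exactly one.
    have hf : (1 - Polynomial.C (star b) * Polynomial.X : Polynomial ℂ).eval b ≠ 0 := by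
      simpa using hb
    have hf0 : (1 - Polynomial.C (star b) * Polynomial.X : Polynomial ℂ) ≠ 0 := by
      intro h
      rw [h] at hf
      simp at hf
    have hr : Polynomial.C c * P.det * (1 - Polynomial.C (star b) * Polynomial.X) ≠ 0 :=
      mul_ne_zero (mul_ne_zero (Polynomial.C_ne_zero.mpr hc) hP) hf0
    have hQ0 : Q.det ≠ 0 := by
      intro h
      rw [h, zero_mul] at hdet
      exact hr hdet.symm
    have hm := congrArg (Polynomial.rootMultiplicity b) hdet
    rw [Polynomial.rootMultiplicity_mul (hdet ▸ hr), Polynomial.rootMultiplicity_mul hr,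
      Polynomial.rootMultiplicity_mul (left_ne_zero_of_mul hr), Polynomial.rootMultiplicity_C,
      Polynomial.rootMultiplicity_X_sub_C_self,
      Polynomial.rootMultiplicity_eq_zero (p := 1 - _) hf] at hm
    obtain ⟨Q', hQ', h'⟩ := ih Q hQ0 (by omega)
    exact ⟨Q', hQ'.trans hQ, h'⟩

/-! ### Dividing scalar factors out of a Gram matrix -/

/-- The adjoint at z is the conjugate transpose of the value at 1/conj z, so a Gram identity couples
the values of P at reflected points. -/
theorem ev_gram_apply (P : Matrix (Fin m) (Fin m) (Polynomial ℂ)) (z : ℂˣ) :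
    (gram P).map (ev z) = P.map (Polynomial.eval (z : ℂ)) *
      (P.map (Polynomial.eval (refl z : ℂ)))ᴴ := by
  ext1 i k
  simp only [Matrix.map_apply, gram_apply, map_sum, map_mul, ev_adj, ev_toLaurent, Matrix.mul_apply,
    Matrix.conjTranspose_apply]

/-- `z - a` can be divided out of a factorization of `(z - a)(1/z - conj a) S`. -/
theorem exists_gram_eq_of_mul (S : Matrix (Fin m) (Fin m) (LaurentPolynomial ℂ)) (hS : S.det ≠ 0)
    (a : ℂ) (P : Matrix (Fin m) (Fin m) (Polynomial ℂ))
    (hP : gram P = ((Polynomial.X - Polynomial.C a).toLaurent *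
        adj (Polynomial.X - Polynomial.C a).toLaurent) • S) :
    ∃ Q : Matrix (Fin m) (Fin m) (Polynomial ℂ), gram Q = S := by
  -- For a = 0 the scalar factor is z · z⁻¹ = 1, so there is nothing to divide out.
  by_cases ha : a = 0
  · refine ⟨P, ?_⟩
    rw [hP, ha]
    rw [map_zero, sub_zero, Polynomial.toLaurent_X, adj_T, ← LaurentPolynomial.T_add, add_neg_cancel,
      LaurentPolynomial.T_zero, one_smul]
  have hX : (Polynomial.X - Polynomial.C a).toLaurent ≠ 0 := by
    rw [Polynomial.toLaurent_ne_zero]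
    exact Polynomial.X_sub_C_ne_zero a
  have hXX : (Polynomial.X - Polynomial.C a).toLaurent *
        adj (Polynomial.X - Polynomial.C a).toLaurent ≠ 0 :=
    mul_ne_zero hX ((map_ne_zero_iff adj adj_injective).mpr hX)
  have hdet : P.det ≠ 0 := by
    intro h
    have h2 := det_gram P
    rw [hP, Matrix.det_smul, h, map_zero, zero_mul] at h2
    exact mul_ne_zero (pow_ne_zero _ hXX) hS h2
  lift a to ℂˣ using isUnit_iff_ne_zero.mpr ha
  have key : ∃ Q : Matrix (Fin m) (Fin m) (Polynomial ℂ), gram Q = gram P ∧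
      Q.map (Polynomial.eval (a : ℂ)) = 0 := by
    have hz (Q : Matrix (Fin m) (Fin m) (Polynomial ℂ)) (hQ : gram Q = gram P) :
        Q.map (Polynomial.eval (a : ℂ)) * (Q.map (Polynomial.eval (refl a : ℂ)))ᴴ = 0 := by
      rw [← ev_gram_apply, hQ, hP]
      ext1 i k
      simp only [Matrix.map_apply, Matrix.smul_apply, smul_eq_mul, map_mul, ev_toLaurent,
        Polynomial.eval_sub, Polynomial.eval_X, Polynomial.eval_C, sub_self, zero_mul,
        Matrix.zero_apply]
    -- On the circle Q(a) Q(a)ᴴ = 0 already forces Q(a) = 0. Off it, flips make Q(1/conj a)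
    -- invertible, and it cancels from Q(a) Q(1/conj a)ᴴ = 0.
    by_cases hc : refl a = a
    · refine ⟨P, rfl, ?_⟩
      have := hz P rfl
      rwa [hc, Matrix.self_mul_conjTranspose_eq_zero] at this
    · obtain ⟨Q, hQ, hQ0⟩ := exists_eval_det_ne_zero (refl a : ℂ) (by
        intro h
        apply hc
        have h1 : star (refl a : ℂ) * (refl a : ℂ) = 1 := by linear_combination -h
        have h2 : star (refl a : ℂ) * (a : ℂ) = 1 := by simp [refl_coe]
        ext
        exact mul_left_cancel₀ (left_ne_zero_of_mul_eq_one h1) (h1.trans h2.symm)) P hdet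
      refine ⟨Q, hQ, ?_⟩
      rw [eval_det] at hQ0
      have hu : IsUnit ((Q.map (Polynomial.eval (refl a : ℂ)))ᴴ) := by
        rw [Matrix.isUnit_iff_isUnit_det, Matrix.det_conjTranspose, isUnit_iff_ne_zero]
        exact star_ne_zero.mpr hQ0
      exact hu.mul_left_eq_zero.mp (hz Q hQ)
  obtain ⟨Q, hQ, hQa⟩ := key
  have hdvd : ∀ i j, (Polynomial.X - Polynomial.C (a : ℂ)) ∣ Q i j := fun i j =>
    Polynomial.dvd_iff_isRoot.mpr (congrFun (congrFun hQa i) j)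
  choose R hR using hdvd
  refine ⟨Matrix.of R, ?_⟩
  rw [hP] at hQ
  ext1 i k
  have := congrFun (congrFun hQ i) k
  rw [gram_apply, Matrix.smul_apply, smul_eq_mul] at this
  apply mul_left_cancel₀ hXX
  rw [← this, gram_apply, Finset.mul_sum]
  refine Finset.sum_congr rfl fun j _ => ?_
  rw [hR i j, hR k j]
  simp only [map_mul, Matrix.of_apply]
  ring

theorem sum_mul_mul_eq_of_inverse {R ι : Type*} [CommRing R] [Fintype ι] (u v : ι → R)
    {x y x' y' s : R} (h1 : x * y = 1) (h2 : x' * y' = 1) (h : ∑ j, u j * v j = y * y' * s) :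
    ∑ j, x * u j * (x' * v j) = s := by
  calc _ = x * x' * ∑ j, u j * v j := by
          rw [Finset.mul_sum]
          exact Finset.sum_congr rfl fun j _ => by ring
    _ = s := by rw [h]; linear_combination (x' * y' * s) * h1 + s * h2

/-- A factorization of `d d̃ S` yields a factorization of `S`. -/
theorem exists_gram_eq (S : Matrix (Fin m) (Fin m) (LaurentPolynomial ℂ)) (hS : S.det ≠ 0)
    (d : Polynomial ℂ) (hd : d ≠ 0) (P : Matrix (Fin m) (Fin m) (Polynomial ℂ))
    (hP : gram P = (d.toLaurent * adj d.toLaurent) • S) :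
    ∃ Q : Matrix (Fin m) (Fin m) (Polynomial ℂ), gram Q = S := by
  induction hk : d.natDegree generalizing d P with
  | zero =>
    obtain ⟨c, rfl⟩ := Polynomial.natDegree_eq_zero.mp hk
    have hc : c ≠ 0 := Polynomial.C_ne_zero.mp hd
    refine ⟨Polynomial.C c⁻¹ • P, ?_⟩
    ext1 i k
    have h := congrFun (congrFun hP i) k
    rw [gram_apply, Matrix.smul_apply, smul_eq_mul] at h
    rw [gram_apply]
    simp only [Matrix.smul_apply, smul_eq_mul, map_mul, Polynomial.toLaurent_C, adj_C] at h ⊢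
    have h1 : LaurentPolynomial.C c⁻¹ * LaurentPolynomial.C c = 1 := by
      rw [← map_mul, inv_mul_cancel₀ hc, map_one]
    have h2 : LaurentPolynomial.C (star c⁻¹) * LaurentPolynomial.C (star c) = 1 := by
      rw [← map_mul, ← star_mul', inv_mul_cancel₀ hc, star_one, map_one]
    exact sum_mul_mul_eq_of_inverse _ _ h1 h2 h
  | succ k ih =>
    obtain ⟨a, ha⟩ := Complex.exists_root (f := d)
      (Polynomial.natDegree_pos_iff_degree_pos.mp (by omega))
    obtain ⟨e, rfl⟩ := Polynomial.dvd_iff_isRoot.mpr ha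
    have he : e ≠ 0 := right_ne_zero_of_mul hd
    have hle : e.toLaurent ≠ 0 := Polynomial.toLaurent_ne_zero.mpr he
    have hdet : ((e.toLaurent * adj e.toLaurent) • S).det ≠ 0 := by
      rw [Matrix.det_smul]
      exact mul_ne_zero (pow_ne_zero _ (mul_ne_zero hle
        ((map_ne_zero_iff adj adj_injective).mpr hle))) hS
    have hmul : ((Polynomial.X - Polynomial.C a) * e).toLaurent *
        adj ((Polynomial.X - Polynomial.C a) * e).toLaurent =
        ((Polynomial.X - Polynomial.C a).toLaurent * adj (Polynomial.X - Polynomial.C a).toLaurent) *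
          (e.toLaurent * adj e.toLaurent) := by
      rw [map_mul, map_mul]
      exact mul_mul_mul_comm _ _ _ _
    rw [hmul, ← smul_smul] at hP
    obtain ⟨Q, hQ⟩ := exists_gram_eq_of_mul _ hdet a P hP
    refine ih e he Q hQ ?_
    rw [Polynomial.natDegree_mul (Polynomial.X_sub_C_ne_zero a) he, Polynomial.natDegree_X_sub_C] at hk
    omega

/-! ### The scalar Fejér–Riesz theorem -/

/-- The point `exp (i θ)` of the unit circle as a unit of `ℂ`. -/
abbrev cu (θ : ℝ) : ℂˣ := Circle.toUnits (Circle.exp θ)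

theorem cu_coe (θ : ℝ) : (cu θ : ℂ) = Complex.exp (θ * Complex.I) := by
  simp [cu, Circle.coe_exp]

theorem refl_cu (θ : ℝ) : refl (cu θ) = cu θ := by
  ext
  have h := Circle.coe_inv_eq_conj (Circle.exp θ)
  rw [refl_coe, inv_eq_iff_eq_inv]
  simp only [cu, Circle.toUnits_apply, Units.val_mk0]
  exact h.symm

theorem ev_cu_adj (θ : ℝ) (f : LaurentPolynomial ℂ) : ev (cu θ) (adj f) = star (ev (cu θ) f) := by
  rw [ev_adj, refl_cu]

/-- Up to a power of z, f is a polynomial; it has finitely many roots, each attained for at most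
countably many θ. -/
theorem ae_ev_ne_zero {f : LaurentPolynomial ℂ} (hf : f ≠ 0) : ∀ᵐ θ : ℝ, ev (cu θ) f ≠ 0 := by
  obtain ⟨n, p, hp⟩ := LaurentPolynomial.exists_T_pow f
  have hp0 : p ≠ 0 := by
    rintro rfl
    rw [map_zero] at hp
    exact mul_ne_zero hf (LaurentPolynomial.isUnit_T _).ne_zero hp.symm
  have hc : (⋃ a ∈ p.roots.toFinset, {θ : ℝ | (cu θ : ℂ) = a}).Countable := by
    refine Set.Countable.biUnion (Finset.countable_toSet _) fun a _ => ?_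
    by_cases hne : ∃ θ₀ : ℝ, (cu θ₀ : ℂ) = a
    · obtain ⟨θ₀, rfl⟩ := hne
      refine (Set.countable_range fun k : ℤ => θ₀ + k * (2 * Real.pi)).mono fun θ hθ => ?_
      have : Circle.exp θ = Circle.exp θ₀ := by
        ext
        simpa [cu] using hθ
      obtain ⟨k, hk⟩ := Circle.exp_eq_exp.mp this
      exact ⟨k, hk.symm⟩
    · convert Set.countable_empty
      ext θ
      simpa using fun h => hne ⟨θ, h⟩
  have h0 := hc.ae_notMem (volume : Measure ℝ)
  filter_upwards [h0] with θ hθ hz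
  apply hθ
  have h1 : p.eval (cu θ : ℂ) = 0 := by
    rw [← ev_toLaurent, hp, map_mul, hz, zero_mul]
  simp only [Set.mem_iUnion, Set.mem_ofPred_eq]
  exact ⟨_, by rw [Multiset.mem_toFinset, Polynomial.mem_roots hp0]; exact h1, rfl⟩

theorem eq_of_ae_ev_eq {f g : LaurentPolynomial ℂ} (h : ∀ᵐ θ : ℝ, ev (cu θ) f = ev (cu θ) g) :
    f = g := by
  by_contra hne
  have h1 := (ae_ev_ne_zero (sub_ne_zero.mpr hne)).and h
  obtain ⟨θ, hθ, hθ'⟩ := h1.exists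
  exact hθ (by rw [map_sub, hθ', sub_self])

theorem differentiable_ev_cu (f : LaurentPolynomial ℂ) : Differentiable ℝ fun θ => ev (cu θ) f := by
  induction f using LaurentPolynomial.induction_on' with
  | add p q hp hq =>
    simp only [map_add]
    exact hp.add hq
  | C_mul_T n a =>
    have : (fun θ : ℝ => ev (cu θ) (LaurentPolynomial.C a * LaurentPolynomial.T n)) =
        fun θ : ℝ => a * Complex.exp (n * (θ * Complex.I)) := by
      ext θ
      rw [ev, LaurentPolynomial.eval₂_C_mul_T, Units.val_zpow_eq_zpow_val, cu_coe, Complex.exp_int_mul]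
      rfl
    rw [this]
    have h1 : Differentiable ℝ fun θ : ℝ => (θ : ℂ) := Complex.ofRealCLM.differentiable
    fun_prop

theorem ev_cu_nonneg {f : LaurentPolynomial ℂ} (h : ∀ᵐ θ : ℝ, 0 ≤ ev (cu θ) f) (θ : ℝ) :
    0 ≤ ev (cu θ) f := by
  have hd := Measure.dense_of_ae h
  have hc : IsClosed {θ : ℝ | 0 ≤ ev (cu θ) f} :=
    isClosed_le continuous_const (differentiable_ev_cu f).continuous
  have := hd.closure_eq
  rw [hc.closure_eq] at this
  exact Set.eq_univ_iff_forall.mp this θ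

/-- A zero on the unit circle of a Laurent polynomial that is nonnegative there is multiple. -/
theorem ev_eq_zero_of_nonneg {f g : LaurentPolynomial ℂ} (h : ∀ᵐ θ : ℝ, 0 ≤ ev (cu θ) f) (θ₀ : ℝ)
    (hfg : f = (Polynomial.X - Polynomial.C (cu θ₀ : ℂ)).toLaurent * g) : ev (cu θ₀) g = 0 := by
  have hnn := ev_cu_nonneg h
  have hz : ev (cu θ₀) f = 0 := by
    rw [hfg, map_mul, ev_toLaurent]; simp
  have h1 : HasDerivAt (fun θ : ℝ => (cu θ : ℂ) - cu θ₀) (cu θ₀ * Complex.I) θ₀ := by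
    simp only [cu_coe]
    have h2 : HasDerivAt (fun θ : ℝ => (θ : ℂ) * Complex.I) Complex.I θ₀ := by
      simpa using (Complex.ofRealCLM.hasDerivAt (x := θ₀)).mul_const Complex.I
    exact h2.cexp.sub_const _
  have h3 := h1.mul (differentiable_ev_cu g θ₀).hasDerivAt
  have h4 : HasDerivAt (fun θ : ℝ => ev (cu θ) f) (cu θ₀ * Complex.I * ev (cu θ₀) g) θ₀ := by
    convert! h3 using 1
    · ext θ
      rw [hfg, map_mul, ev_toLaurent]; simp
    · simp
  have hre : HasDerivAt (fun θ : ℝ => (ev (cu θ) f).re) (cu θ₀ * Complex.I * ev (cu θ₀) g).re θ₀ :=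
    Complex.reCLM.hasFDerivAt.comp_hasDerivAt θ₀ h4
  have him : HasDerivAt (fun θ : ℝ => (ev (cu θ) f).im) (cu θ₀ * Complex.I * ev (cu θ₀) g).im θ₀ :=
    Complex.imCLM.hasFDerivAt.comp_hasDerivAt θ₀ h4
  have hmin : IsLocalMin (fun θ : ℝ => (ev (cu θ) f).re) θ₀ := by
    refine Filter.Eventually.of_forall fun θ => ?_
    simp only [hz, Complex.zero_re]
    exact (Complex.nonneg_iff.mp (hnn θ)).1
  have him0 : (fun θ : ℝ => (ev (cu θ) f).im) = fun _ => 0 :=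
    funext fun θ => (Complex.nonneg_iff.mp (hnn θ)).2.symm
  rw [him0] at him
  -- The derivative of f along the circle at θ₀ vanishes: its real part by minimality, its imaginary
  -- part because f is real there.
  have e : (cu θ₀ : ℂ) * Complex.I * ev (cu θ₀) g = 0 :=
    Complex.ext (hmin.hasDerivAt_eq_zero hre) (him.unique (hasDerivAt_const _ _))
  exact (mul_eq_zero.mp e).resolve_left (mul_ne_zero (Units.ne_zero _) Complex.I_ne_zero)

theorem nonneg_of_mul_nonneg_right_of_pos {a b : ℂ} (ha : 0 < a) (h : 0 ≤ a * b) : 0 ≤ b := by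
  rcases eq_or_ne b 0 with rfl | hb
  · exact le_rfl
  · exact ((pos_iff_pos_of_mul_pos
      (lt_of_le_of_ne h (mul_ne_zero ha.ne' hb).symm)).mp ha).le

theorem mul_star_pos {a : ℂ} (ha : a ≠ 0) : 0 < a * star a := by
  have : a * star a = (Complex.normSq a : ℂ) := Complex.mul_conj a
  rw [this]
  exact_mod_cast Complex.normSq_pos.mpr ha

theorem adj_eq_of_ae_nonneg {f : LaurentPolynomial ℂ} (h : ∀ᵐ θ : ℝ, 0 ≤ ev (cu θ) f) :
    adj f = f := by
  apply eq_of_ae_ev_eq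
  filter_upwards [h] with θ hθ
  rw [ev_cu_adj]
  exact Complex.conj_eq_iff_im.mpr (Complex.nonneg_iff.mp hθ).2.symm

/-- Base case of Fejér–Riesz: a nonzero monomial that is real on the circle has exponent 0, and its
coefficient is then a nonnegative real with a square root. -/
theorem exists_mul_adj_eq_C_mul_T (c : ℂ) (k : ℤ)
    (h : ∀ᵐ θ : ℝ, 0 ≤ ev (cu θ) (LaurentPolynomial.C c * LaurentPolynomial.T k)) :
    ∃ q : LaurentPolynomial ℂ, q * adj q = LaurentPolynomial.C c * LaurentPolynomial.T k := by
  rcases eq_or_ne c 0 with rfl | hc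
  · exact ⟨0, by simp⟩
  have hs := adj_eq_of_ae_nonneg h
  have hk : k = 0 := by
    by_contra hk
    have h1 := congrArg (fun f => f.coeff k) hs
    simp only [coeff_adj, ← LaurentPolynomial.single_eq_C_mul_T, AddMonoidAlgebra.coeff_single,
      Finsupp.single_apply, if_true] at h1
    rw [if_neg (by omega), star_zero] at h1
    exact hc h1.symm
  subst hk
  have h0 : 0 ≤ c := by simpa using ev_cu_nonneg h 0
  obtain ⟨hr, hi⟩ := Complex.nonneg_iff.mp h0
  refine ⟨LaurentPolynomial.C (Real.sqrt c.re : ℂ), ?_⟩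
  rw [adj_C, ← map_mul, LaurentPolynomial.T_zero, mul_one]
  congr 1
  rw [Complex.star_def, Complex.conj_ofReal, ← Complex.ofReal_mul, Real.mul_self_sqrt hr]
  exact Complex.ext rfl hi

/-- The scalar Fejér–Riesz theorem. -/
theorem exists_mul_adj_eq (f : LaurentPolynomial ℂ) (h : ∀ᵐ θ : ℝ, 0 ≤ ev (cu θ) f) :
    ∃ q : LaurentPolynomial ℂ, q * adj q = f := by
  suffices H : ∀ (d : ℕ) (p : Polynomial ℂ) (k : ℤ), p.natDegree ≤ d →
      (∀ᵐ θ : ℝ, 0 ≤ ev (cu θ) (p.toLaurent * LaurentPolynomial.T k)) →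
      ∃ q : LaurentPolynomial ℂ, q * adj q = p.toLaurent * LaurentPolynomial.T k by
    obtain ⟨n, p, hp⟩ := LaurentPolynomial.exists_T_pow f
    have hf : f = p.toLaurent * LaurentPolynomial.T (-n) := by
      rw [hp, mul_assoc, ← LaurentPolynomial.T_add, add_neg_cancel, LaurentPolynomial.T_zero, mul_one]
    rw [hf] at h ⊢
    exact H _ p _ le_rfl h
  intro d
  induction d with
  | zero =>
    intro p k hd h
    obtain ⟨c, rfl⟩ := Polynomial.natDegree_eq_zero.mp (Nat.le_zero.mp hd)
    rw [Polynomial.toLaurent_C] at h ⊢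
    exact exists_mul_adj_eq_C_mul_T c k h
  | succ d ih =>
    intro p k hd h
    rcases Nat.lt_or_ge d p.natDegree with hlt | hle
    swap
    · exact ih p k hle h
    obtain ⟨a, ha⟩ := Complex.exists_root (f := p)
      (Polynomial.natDegree_pos_iff_degree_pos.mp (by omega))
    have hp0 : p ≠ 0 := by
      rintro rfl
      simp at hlt
    obtain ⟨p₁, hp₁⟩ := Polynomial.dvd_iff_isRoot.mpr ha
    have hp₁0 : p₁ ≠ 0 := by
      rintro rfl
      exact hp0 (by rw [hp₁, mul_zero])
    have hdeg : p.natDegree = 1 + p₁.natDegree := by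
      rw [hp₁, Polynomial.natDegree_mul (Polynomial.X_sub_C_ne_zero a) hp₁0,
        Polynomial.natDegree_X_sub_C]
    by_cases ha0 : a = 0
    · have e : p.toLaurent * LaurentPolynomial.T k = p₁.toLaurent * LaurentPolynomial.T (1 + k) := by
        rw [hp₁, ha0, map_zero, sub_zero, map_mul, Polynomial.toLaurent_X, LaurentPolynomial.T_add]
        ring
      rw [e] at h ⊢
      exact ih p₁ _ (by omega) h
    lift a to ℂˣ using isUnit_iff_ne_zero.mpr ha0
    have hT : ∀ z : ℂˣ, ev z (LaurentPolynomial.T k) ≠ 0 := fun z =>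
      ((LaurentPolynomial.isUnit_T k).map (ev z)).ne_zero
    have hroot : p.eval (refl a : ℂ) = 0 := by
      have h1 : ev (refl a) (p.toLaurent * LaurentPolynomial.T k) = 0 := by
        rw [← adj_eq_of_ae_nonneg h, ev_adj, refl_refl, map_mul, ev_toLaurent, ha, zero_mul, star_zero]
      rw [map_mul, ev_toLaurent] at h1
      exact (mul_eq_zero.mp h1).resolve_right (hT _)
    -- Roots come in pairs a, 1/conj a. On the circle the two coincide, and nonnegativity supplies
    -- the second copy of the root.
    have hroot₁ : p₁.eval (refl a : ℂ) = 0 := by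
      by_cases hc : refl a = a
      · have hn : ‖(a : ℂ)‖ = 1 := by
          have h2 := refl_coe a
          rw [hc] at h2
          have h3 := congrArg norm h2
          rw [norm_inv, norm_star] at h3
          have h4 : ‖(a : ℂ)‖ ≠ 0 := norm_ne_zero_iff.mpr ha0
          have h5 : ‖(a : ℂ)‖ * ‖(a : ℂ)‖ = 1 := by
            nth_rewrite 1 [h3]
            exact inv_mul_cancel₀ h4
          nlinarith [norm_nonneg (a : ℂ)]
        obtain ⟨θ₀, hθ₀⟩ : ∃ θ₀ : ℝ, a = cu θ₀ := by
          refine ⟨Complex.arg a, ?_⟩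
          ext
          rw [cu_coe]
          have := Complex.norm_mul_exp_arg_mul_I (a : ℂ)
          rw [hn, Complex.ofReal_one, one_mul] at this
          exact this.symm
        have h6 := ev_eq_zero_of_nonneg (g := p₁.toLaurent * LaurentPolynomial.T k) h θ₀ (by
          rw [hp₁, map_mul, mul_assoc, hθ₀])
        rw [map_mul, ev_toLaurent, ← hθ₀] at h6
        rw [hc]
        exact (mul_eq_zero.mp h6).resolve_right (hT _)
      · rw [hp₁, Polynomial.eval_mul] at hroot
        refine (mul_eq_zero.mp hroot).resolve_left fun h7 => hc ?_
        ext
        simpa [sub_eq_zero] using h7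
    obtain ⟨p₂, hp₂⟩ := Polynomial.dvd_iff_isRoot.mpr hroot₁
    have hp₂0 : p₂ ≠ 0 := by
      rintro rfl
      exact hp₁0 (by rw [hp₂, mul_zero])
    have hdeg₁ : p₁.natDegree = 1 + p₂.natDegree := by
      rw [hp₂, Polynomial.natDegree_mul (Polynomial.X_sub_C_ne_zero _) hp₂0,
        Polynomial.natDegree_X_sub_C]
    -- With r = 1/conj a one has z - r = -r z (1/z - conj a), which accounts for the constant -r and
    -- the shift from k to 1 + k.
    have e : p.toLaurent * LaurentPolynomial.T k =
        (Polynomial.X - Polynomial.C (a : ℂ)).toLaurent *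
          adj (Polynomial.X - Polynomial.C (a : ℂ)).toLaurent *
        ((Polynomial.C (-(refl a : ℂ)) * p₂).toLaurent * LaurentPolynomial.T (1 + k)) := by
      have h1 : LaurentPolynomial.C (refl a : ℂ) * LaurentPolynomial.C (star (a : ℂ)) = 1 := by
        rw [← map_mul]; simp [refl_coe]
      have h2 : (LaurentPolynomial.T 1 : LaurentPolynomial ℂ) * LaurentPolynomial.T (-1) = 1 := by
        rw [← LaurentPolynomial.T_add]; simp
      rw [hp₁, hp₂, adj_X_sub_C, LaurentPolynomial.T_add]
      simp only [map_sub, map_mul, map_one, map_neg, Polynomial.toLaurent_X, Polynomial.toLaurent_C]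
      generalize LaurentPolynomial.C (refl a : ℂ) = r at *
      generalize LaurentPolynomial.C (star (a : ℂ)) = s at *
      generalize LaurentPolynomial.C (a : ℂ) = t at *
      generalize (LaurentPolynomial.T 1 : LaurentPolynomial ℂ) = u at *
      generalize (LaurentPolynomial.T (-1) : LaurentPolynomial ℂ) = u' at *
      linear_combination ((u - t) * p₂.toLaurent * LaurentPolynomial.T k) *
        ((r - r * s * u) * h2 - u * h1)
    have hX : (Polynomial.X - Polynomial.C (a : ℂ)).toLaurent ≠ 0 :=
      Polynomial.toLaurent_ne_zero.mpr (Polynomial.X_sub_C_ne_zero _)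
    rw [e] at h ⊢
    obtain ⟨q, hq⟩ := ih (Polynomial.C (-(refl a : ℂ)) * p₂) (1 + k)
      ((Polynomial.natDegree_C_mul_le _ _).trans (by omega)) (by
        filter_upwards [h, ae_ev_ne_zero hX] with θ h1 h2
        rw [map_mul, map_mul _ _ (adj _), ev_cu_adj] at h1
        exact nonneg_of_mul_nonneg_right_of_pos (mul_star_pos h2) h1)
    refine ⟨(Polynomial.X - Polynomial.C (a : ℂ)).toLaurent * q, ?_⟩
    rw [map_mul, mul_mul_mul_comm, hq]

/-! ### Existence of a factor: matrix Fejér–Riesz -/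

/-- The Schur complement, without division, of a positive definite matrix is positive definite. -/
theorem posDef_schur {M : Matrix (Fin (m + 1)) (Fin (m + 1)) ℂ} (hM : M.PosDef) :
    (Matrix.of fun i k : Fin m => M 0 0 * M i.succ k.succ - M i.succ 0 * M 0 k.succ).PosDef := by
  have hH : ∀ i j, star (M i j) = M j i := fun i j => hM.1.apply j i
  have h00 : 0 < M 0 0 := hM.diag_pos
  rw [Matrix.posDef_iff_dotProduct_mulVec] at hM ⊢
  refine ⟨Matrix.IsHermitian.ext fun i j => ?_, fun x hx => ?_⟩
  · simp only [Matrix.of_apply, star_sub, star_mul', hH]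
    ring
  · set b : ℂ := ∑ k : Fin m, M 0 k.succ * x k with hb
    -- This test vector X makes the first entry of M X vanish, so X* M X is `M 0 0` times the
    -- quadratic form of the Schur complement at x.
    have hX : (Fin.cons (-b) (fun k => M 0 0 * x k) : Fin (m + 1) → ℂ) ≠ 0 := by
      intro h
      apply hx
      ext k
      have := congrFun h k.succ
      simpa [h00.ne'] using this
    have h := hM.2 hX
    refine (pos_iff_pos_of_mul_pos (a := M 0 0) ?_).mp h00
    convert h using 1
    simp only [dotProduct, Matrix.mulVec, Fin.sum_univ_succ, Pi.star_apply, Fin.cons_zero,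
      Fin.cons_succ, star_mul', hH, Matrix.of_apply, Finset.mul_sum]
    have h1 : M 0 0 * -b + ∑ k : Fin m, M 0 k.succ * (M 0 0 * x k) = 0 := by
      rw [hb, mul_neg, Finset.mul_sum, neg_add_eq_zero]
      exact Finset.sum_congr rfl fun k _ => by ring
    rw [h1, mul_zero, zero_add]
    refine Finset.sum_congr rfl fun i _ => ?_
    rw [mul_add, Finset.mul_sum, hb, mul_neg, mul_neg, Finset.mul_sum, Finset.mul_sum,
      ← Finset.sum_neg_distrib, ← Finset.sum_add_distrib]
    exact Finset.sum_congr rfl fun k _ => by ring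

theorem adj_apply_of_posDefAE {S : Matrix (Fin m) (Fin m) (LaurentPolynomial ℂ)} (hS : PosDefAE S)
    (i j : Fin m) : adj (S i j) = S j i := by
  apply eq_of_ae_ev_eq
  filter_upwards [hS] with θ hθ
  rw [ev_cu_adj]
  exact hθ.1.apply j i

theorem det_ne_zero_of_posDefAE {S : Matrix (Fin m) (Fin m) (LaurentPolynomial ℂ)}
    (hS : PosDefAE S) : S.det ≠ 0 := by
  intro h
  obtain ⟨θ, hθ⟩ := hS.exists
  have h1 : (evalAt S (cu θ)).det = ev (cu θ) S.det := by
    rw [RingHom.map_det]; rfl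
  rw [h, map_zero] at h1
  exact hθ.det_pos.ne' h1

/-- A Laurent polynomial matrix that is positive definite almost everywhere on the circle factors
over the rational functions. -/
theorem exists_rational_factor (S : Matrix (Fin m) (Fin m) (LaurentPolynomial ℂ))
    (hS : PosDefAE S) :
    ∃ (A : Matrix (Fin m) (Fin m) (LaurentPolynomial ℂ)) (d : LaurentPolynomial ℂ), d ≠ 0 ∧
      ∀ i k, ∑ j, A i j * adj (A k j) = d * adj d * S i k := by
  induction m with
  | zero => exact ⟨0, 1, one_ne_zero, fun i => i.elim0⟩
  | succ m ih =>
    have hpos : ∀ᵐ θ : ℝ, 0 < ev (cu θ) (S 0 0) := by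
      filter_upwards [hS] with θ hθ
      exact hθ.diag_pos (i := 0)
    obtain ⟨q, hq⟩ := exists_mul_adj_eq (S 0 0) (hpos.mono fun θ h => h.le)
    have hq0 : q ≠ 0 := by
      rintro rfl
      obtain ⟨θ, hθ⟩ := hpos.exists
      rw [← hq, zero_mul, map_zero] at hθ
      exact hθ.false
    obtain ⟨A, d, hd, hA⟩ := ih (Matrix.of fun i k : Fin m =>
        S 0 0 * S i.succ k.succ - S i.succ 0 * S 0 k.succ) (by
      filter_upwards [hS] with θ hθ
      convert posDef_schur hθ using 1
      ext i k
      simp [evalAt])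
    -- One step of Cholesky elimination over the common denominator q d: the first column is
    -- S_{i0}/q, and the factor of the Schur complement fills the lower right block.
    refine ⟨Matrix.of fun i j => Fin.cases (d * S i 0) (fun j' => Fin.cases 0 (fun i' => A i' j') i) j,
      q * d, mul_ne_zero hq0 hd, fun i k => ?_⟩
    have hadj := adj_apply_of_posDefAE hS
    simp only [Fin.sum_univ_succ, Matrix.of_apply, Fin.cases_zero, Fin.cases_succ, map_mul, hadj]
    refine Fin.cases ?_ (fun i' => ?_) i <;> refine Fin.cases ?_ (fun k' => ?_) k
    · simp only [Fin.cases_zero, map_zero, mul_zero, Finset.sum_const_zero]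
      rw [← hq]; ring
    · simp only [Fin.cases_zero, zero_mul, Finset.sum_const_zero]
      rw [← hq]; ring
    · simp only [Fin.cases_zero, map_zero, mul_zero, Finset.sum_const_zero]
      rw [← hq]; ring
    · simp only [Fin.cases_succ, hA, Matrix.of_apply]
      rw [← hq]; ring

theorem exists_toLaurent_eq_mul_T {ι : Type*} [Fintype ι] (f : ι → LaurentPolynomial ℂ) :
    ∃ n : ℕ, ∀ i, ∃ p : Polynomial ℂ, p.toLaurent = f i * LaurentPolynomial.T n := by
  choose n p hp using fun i => LaurentPolynomial.exists_T_pow (f i)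
  refine ⟨∑ i, n i, fun i => ?_⟩
  have hle : n i ≤ ∑ i, n i := Finset.single_le_sum (fun _ _ => Nat.zero_le _) (Finset.mem_univ i)
  refine ⟨p i * Polynomial.X ^ (∑ i, n i - n i), ?_⟩
  rw [map_mul, hp, Polynomial.toLaurent_X_pow, mul_assoc, ← LaurentPolynomial.T_add]
  congr 2
  omega

theorem exists_gram_eq_of_posDefAE (S : Matrix (Fin m) (Fin m) (LaurentPolynomial ℂ))
    (hS : PosDefAE S) : ∃ P : Matrix (Fin m) (Fin m) (Polynomial ℂ), gram P = S := by
  obtain ⟨A, d, hd, hA⟩ := exists_rational_factor S hS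
  have hT (f g : LaurentPolynomial ℂ) (n : ℤ) :
      f * LaurentPolynomial.T n * adj (g * LaurentPolynomial.T n) = f * adj g := by
    have h : (LaurentPolynomial.T n : LaurentPolynomial ℂ) * LaurentPolynomial.T (-n) = 1 := by
      rw [← LaurentPolynomial.T_add, add_neg_cancel, LaurentPolynomial.T_zero]
    rw [map_mul, adj_T, mul_mul_mul_comm, h, mul_one]
  obtain ⟨n, hn⟩ := exists_toLaurent_eq_mul_T fun x : Fin m × Fin m => A x.1 x.2
  choose P hP using hn
  obtain ⟨k, e, he⟩ := LaurentPolynomial.exists_T_pow d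
  have he0 : e ≠ 0 := by
    rintro rfl
    rw [map_zero] at he
    exact mul_ne_zero hd (LaurentPolynomial.isUnit_T _).ne_zero he.symm
  refine exists_gram_eq S (det_ne_zero_of_posDefAE hS) e he0 (Matrix.of fun i j => P (i, j)) ?_
  ext1 i j
  rw [gram_apply, Matrix.smul_apply, smul_eq_mul, he, hT, ← hA]
  refine Finset.sum_congr rfl fun l _ => ?_
  rw [Matrix.of_apply, Matrix.of_apply, hP, hP, hT]

/-! ### Degree bounds -/

/-- The degree bound is automatic for factors that are nonsingular at the origin. -/
theorem natDegree_le_of_gram_eq {N : ℕ} {S : Matrix (Fin m) (Fin m) (LaurentPolynomial ℂ)}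
    (hS : ∀ n : ℤ, (N : ℤ) < |n| → coeffMatrix S n = 0)
    {P : Matrix (Fin m) (Fin m) (Polynomial ℂ)} (hP : gram P = S) (h0 : P.det.coeff 0 ≠ 0)
    (i j : Fin m) : (P i j).natDegree ≤ N := by
  suffices H : ∀ t, (∀ i j, (P i j).natDegree ≤ N + t) → ∀ i j, (P i j).natDegree ≤ N by
    refine H (∑ i, ∑ j, (P i j).natDegree) (fun i j => ?_) i j
    calc (P i j).natDegree ≤ ∑ j, (P i j).natDegree :=
          Finset.single_le_sum (f := fun j => (P i j).natDegree) (fun _ _ => Nat.zero_le _)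
            (Finset.mem_univ j)
      _ ≤ ∑ i, ∑ j, (P i j).natDegree :=
          Finset.single_le_sum (f := fun i => ∑ j, (P i j).natDegree) (fun _ _ => Nat.zero_le _)
            (Finset.mem_univ i)
      _ ≤ _ := Nat.le_add_left _ _
  intro t
  induction t with
  | zero => exact fun h => h
  | succ t ih =>
    refine fun h => ih fun i j => ?_
    -- The coefficient of S at -(N + t + 1) is P(0) times the conjugate transpose of the top
    -- coefficient of P. It vanishes and P(0) is invertible, so the degree bound drops by one.
    have hprod : P.map (Polynomial.eval 0) *
        (P.map fun p => p.coeff (N + (t + 1)))ᴴ = 0 := by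
      ext1 i k
      have hc : coeffMatrix S (-((N + (t + 1) : ℕ) : ℤ)) = 0 :=
        hS _ (by rw [abs_neg, Nat.abs_cast]; push_cast; omega)
      have hc' := congrFun (congrFun hc i) k
      simp only [coeffMatrix, Matrix.of_apply, ← hP, gram_apply, AddMonoidAlgebra.coeff_sum,
        Finsupp.finsetSum_apply] at hc'
      rw [← hc', Matrix.mul_apply]
      refine Finset.sum_congr rfl fun l _ => ?_
      rw [coeff_toLaurent_mul_adj _ _ (h k l), Polynomial.coeff_zero_eq_eval_zero]
      rfl
    have hu : IsUnit (P.map (Polynomial.eval 0)) := by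
      rw [Matrix.isUnit_iff_isUnit_det, isUnit_iff_ne_zero, ← eval_det,
        ← Polynomial.coeff_zero_eq_eval_zero]
      exact h0
    have hz := Matrix.conjTranspose_eq_zero.mp (hu.mul_right_eq_zero.mp hprod)
    have hz' : (P i j).coeff (N + (t + 1)) = 0 := congrFun (congrFun hz i) j
    by_contra! hlt
    have heq : (P i j).natDegree = N + (t + 1) := le_antisymm (h i j) hlt
    rw [← heq] at hz'
    have := Polynomial.leadingCoeff_eq_zero.mp hz'
    rw [this] at heq
    simp at heq

theorem natDegree_det_le {N : ℕ} {P : Matrix (Fin m) (Fin m) (Polynomial ℂ)}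
    (h : ∀ i j, (P i j).natDegree ≤ N) : P.det.natDegree ≤ m * N := by
  rw [Matrix.det_apply]
  refine Polynomial.natDegree_sum_le_of_forall_le _ _ fun σ _ => ?_
  refine (Polynomial.natDegree_smul_le _ _).trans ((Polynomial.natDegree_prod_le _ _).trans ?_)
  refine (Finset.sum_le_sum fun i _ => h (σ i) i).trans ?_
  simp

/-! ### Uniqueness up to a unitary -/

/-- Factors whose determinants have the same zeros divide each other. -/
theorem exists_eq_mul {P Q : Matrix (Fin m) (Fin m) (Polynomial ℂ)} (h : gram P = gram Q)
    (hnodup : Q.det.roots.Nodup) (h0 : Q.det.coeff 0 ≠ 0)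
    (hroots : ∀ a : ℂˣ, Q.det.eval (a : ℂ) = 0 → P.det.eval (refl a : ℂ) ≠ 0) :
    ∃ V : Matrix (Fin m) (Fin m) (Polynomial ℂ), P = Q * V := by
  have hQ0 : Q.det ≠ 0 := by
    intro hz
    rw [hz] at h0
    simp at h0
  -- Q⁻¹P is polynomial if adj(Q) P vanishes at each of the simple zeros a of det Q. There adj(Q)(a)
  -- kills Q(a) Q(1/conj a)ᴴ = P(a) P(1/conj a)ᴴ, and the last factor is invertible.
  have hdvd : ∀ i j, Q.det ∣ (Q.adjugate * P) i j := by
    intro i j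
    rcases eq_or_ne ((Q.adjugate * P) i j) 0 with hz | hz
    · rw [hz]; exact dvd_zero _
    rw [IsAlgClosed.dvd_iff_roots_le_roots hQ0 hz, Multiset.le_iff_subset hnodup]
    intro a ha
    have ha' : Q.det.eval a = 0 := (Polynomial.mem_roots hQ0).mp ha
    rw [Polynomial.mem_roots hz]
    have ha0 : a ≠ 0 := by
      rintro rfl
      rw [Polynomial.coeff_zero_eq_eval_zero] at h0
      exact h0 ha'
    lift a to ℂˣ using isUnit_iff_ne_zero.mpr ha0
    have hmap (A B : Matrix (Fin m) (Fin m) (Polynomial ℂ)) :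
        (A * B).map (Polynomial.eval (a : ℂ)) =
          A.map (Polynomial.eval (a : ℂ)) * B.map (Polynomial.eval (a : ℂ)) :=
      Matrix.map_mul (f := Polynomial.evalRingHom (a : ℂ))
    have hadj : Q.adjugate.map (Polynomial.eval (a : ℂ)) * Q.map (Polynomial.eval (a : ℂ)) = 0 := by
      rw [← hmap, Matrix.adjugate_mul]
      ext1 k l
      rw [Matrix.map_apply, Matrix.smul_apply, smul_eq_mul, Polynomial.eval_mul, ha', zero_mul,
        Matrix.zero_apply]
    have hu : IsUnit ((P.map (Polynomial.eval (refl a : ℂ)))ᴴ) := by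
      rw [Matrix.isUnit_iff_isUnit_det, Matrix.det_conjTranspose, isUnit_iff_ne_zero, ← eval_det]
      exact star_ne_zero.mpr (hroots a ha')
    have hz0 : (Q.adjugate * P).map (Polynomial.eval (a : ℂ)) = 0 := by
      rw [← hu.mul_left_eq_zero, hmap, Matrix.mul_assoc, ← ev_gram_apply, h, ev_gram_apply,
        ← Matrix.mul_assoc, hadj, Matrix.zero_mul]
    exact congrFun (congrFun hz0 i) j
  choose V hV using hdvd
  refine ⟨Matrix.of V, ?_⟩
  have h1 : Q.det • P = Q.det • (Q * Matrix.of V) := by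
    have h2 : Q.adjugate * P = Q.det • Matrix.of V := by
      ext1 i j
      rw [hV, Matrix.smul_apply, smul_eq_mul, Matrix.of_apply]
    rw [← Matrix.mul_smul, ← h2, ← Matrix.mul_assoc, Matrix.mul_adjugate, Matrix.smul_mul,
      Matrix.one_mul]
  ext1 i j
  have := congrFun (congrFun h1 i) j
  rw [Matrix.smul_apply, Matrix.smul_apply, smul_eq_mul, smul_eq_mul] at this
  exact mul_left_cancel₀ hQ0 this

theorem mul_left_cancel_of_det_ne_zero {R : Type*} [CommRing R] [IsDomain R]
    {Q A B : Matrix (Fin m) (Fin m) R} (hQ : Q.det ≠ 0) (h : Q * A = Q * B) : A = B := by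
  have h1 := congrArg (Q.adjugate * ·) h
  simp only [← Matrix.mul_assoc, Matrix.adjugate_mul, Matrix.smul_mul, Matrix.one_mul] at h1
  ext1 i j
  have := congrFun (congrFun h1 i) j
  rw [Matrix.smul_apply, Matrix.smul_apply, smul_eq_mul, smul_eq_mul] at this
  exact mul_left_cancel₀ hQ this

/-- A polynomial matrix that is unitary on the circle with polynomial inverse is constant. -/
theorem exists_unitary_of_gram_eq_one {U V : Matrix (Fin m) (Fin m) (Polynomial ℂ)}
    (hU : gram U = 1) (hUV : U * V = 1) :
    ∃ W ∈ Matrix.unitaryGroup (Fin m) ℂ, U = W.map Polynomial.C := by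
  have hinv : matrixAdj U = V.map Polynomial.toLaurent := by
    have h1 : U.map Polynomial.toLaurent * V.map Polynomial.toLaurent = 1 := by
      rw [← Matrix.map_mul, hUV]
      exact Matrix.map_one _ (map_zero _) (map_one _)
    have h2 := mul_eq_one_comm.mp h1
    calc matrixAdj U = V.map Polynomial.toLaurent * U.map Polynomial.toLaurent * matrixAdj U := by
          rw [h2, Matrix.one_mul]
      _ = V.map Polynomial.toLaurent * gram U := by rw [Matrix.mul_assoc, gram]
      _ = _ := by rw [hU, Matrix.mul_one]
  have hconst : U = (U.map (Polynomial.eval 0)).map Polynomial.C := by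
    ext1 i j
    rw [Matrix.map_apply, Matrix.map_apply, ← Polynomial.coeff_zero_eq_eval_zero]
    ext n
    rw [Polynomial.coeff_C]
    split_ifs with hn
    · rw [hn]
    -- The adjoint of U has only nonpositive powers of z and V only nonnegative ones.
    · have h3 : adj (U i j).toLaurent = (V j i).toLaurent := congrFun (congrFun hinv j) i
      have h4 := congrArg (fun f => f.coeff (-(n : ℤ))) h3
      simp only [coeff_adj, neg_neg, coeff_toLaurent_natCast] at h4
      rw [coeff_toLaurent_of_neg _ (by omega)] at h4
      exact star_eq_zero.mp h4
  refine ⟨_, ?_, hconst⟩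
  have h5 := ev_gram_apply U 1
  have h6 : ∀ z : ℂ, U.map (Polynomial.eval z) = U.map (Polynomial.eval 0) := by
    intro z
    conv_lhs => rw [hconst]
    ext1 i j
    simp
  rw [hU, h6, h6 (refl 1 : ℂˣ)] at h5
  rw [Matrix.mem_unitaryGroup_iff, Matrix.star_eq_conjTranspose, ← h5]
  exact Matrix.map_one _ (map_zero _) (map_one _)

theorem exists_unitary_of_roots {P Q : Matrix (Fin m) (Fin m) (Polynomial ℂ)} (h : gram P = gram Q)
    (hsimple : HasOnlySimpleRoots (gram Q).det) (hP0 : P.det.coeff 0 ≠ 0) (hQ0 : Q.det.coeff 0 ≠ 0)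
    (hroots : ∀ a : ℂˣ, Q.det.eval (a : ℂ) = 0 → P.det.eval (refl a : ℂ) ≠ 0) :
    ∃ W ∈ Matrix.unitaryGroup (Fin m) ℂ, P = Q * W.map Polynomial.C := by
  obtain ⟨U, hU⟩ := exists_eq_mul h (roots_nodup hsimple (det_gram Q).symm hQ0) hQ0 hroots
  have hroots' : ∀ a : ℂˣ, P.det.eval (a : ℂ) = 0 → Q.det.eval (refl a : ℂ) ≠ 0 := by
    intro a ha hb
    have := hroots _ hb
    rw [refl_refl] at this
    exact this ha
  rw [← h] at hsimple
  obtain ⟨V, hV⟩ :=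
    exists_eq_mul h.symm (roots_nodup hsimple (det_gram P).symm hP0) hP0 hroots'
  have hQ : Q.det ≠ 0 := by
    intro hz
    rw [hz] at hQ0
    simp at hQ0
  have hUV : U * V = 1 := by
    apply mul_left_cancel_of_det_ne_zero hQ
    rw [← Matrix.mul_assoc, ← hU, ← hV, Matrix.mul_one]
  have hgram : gram U = 1 := by
    have hl : (Q.map Polynomial.toLaurent).det ≠ 0 := by
      rw [det_map_toLaurent]
      exact Polynomial.toLaurent_ne_zero.mpr hQ
    -- Transposing turns the cancellation of Q̃ on the right into one on the left.
    have hr : (matrixAdj Q)ᵀ.det ≠ 0 := by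
      rw [Matrix.det_transpose, det_matrixAdj]
      exact (map_ne_zero_iff adj adj_injective).mpr (Polynomial.toLaurent_ne_zero.mpr hQ)
    have h1 : Q.map Polynomial.toLaurent * (gram U * matrixAdj Q) =
        Q.map Polynomial.toLaurent * (1 * matrixAdj Q) := by
      rw [Matrix.one_mul, ← gram, ← h, hU, gram, gram, matrixAdj_mul, Matrix.map_mul]
      simp only [Matrix.mul_assoc]
    have h2 := congrArg Matrix.transpose (mul_left_cancel_of_det_ne_zero hl h1)
    rw [Matrix.transpose_mul, Matrix.transpose_mul] at h2
    exact Matrix.transpose_injective (mul_left_cancel_of_det_ne_zero hr h2)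
  obtain ⟨W, hW, rfl⟩ := exists_unitary_of_gram_eq_one hgram hUV
  exact ⟨W, hW, hU⟩

/-! ### Counting factors by the zeros of their determinants -/

section Count

variable {N L : ℕ} {S : Matrix (Fin m) (Fin m) (LaurentPolynomial ℂ)}

theorem isSpectralFactor_and_iff (hN : HasMatrixDegree S N) (hL : HasDegree S.det L)
    (P : Matrix (Fin m) (Fin m) (Polynomial ℂ)) :
    (IsSpectralFactor S N P ∧ IsScalarSpectralFactor S.det L P.det) ↔
      gram P = S ∧ P.det.coeff 0 ≠ 0 := by
  constructor
  · rintro ⟨h1, h2⟩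
    exact ⟨h1.mul_adj, (coeff_zero_mul_coeff_ne_zero hL h2.mul_adj h2.natDegree_le).1⟩
  · rintro ⟨h1, h2⟩
    have h3 : P.det.toLaurent * adj P.det.toLaurent = S.det := by rw [← det_gram, h1]
    exact ⟨⟨natDegree_le_of_gram_eq hN.1 h1 h2, h1⟩,
      ⟨natDegree_le_of_coeff_zero_ne_zero hL h3 h2, h3⟩⟩

theorem eval_det_mul_star {P : Matrix (Fin m) (Fin m) (Polynomial ℂ)} (hP : gram P = S) (a : ℂˣ) :
    ev a S.det = P.det.eval (a : ℂ) * star (P.det.eval (refl a : ℂ)) := by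
  rw [← hP, det_gram, map_mul, ev_adj, ev_toLaurent, ev_toLaurent]

theorem eval_det_refl_ne_zero (hsimple : HasOnlySimpleRoots S.det)
    {P : Matrix (Fin m) (Fin m) (Polynomial ℂ)} (hP : gram P = S) (a : ℂˣ)
    (ha : P.det.eval (a : ℂ) = 0) : P.det.eval (refl a : ℂ) ≠ 0 :=
  eval_refl_ne_zero hsimple (by rw [← det_gram, hP]) a ha

/-- The nonzero roots of `det P` among the elements of `R`. -/
def rootsIn (R : Finset ℂ) (P : Matrix (Fin m) (Fin m) (Polynomial ℂ)) : Finset ℂ :=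
  R.filter fun a => P.det.eval a = 0

/-- One zero of the determinant can be reflected, leaving the others in place. -/
theorem exists_rootsIn_eq_erase (hsimple : HasOnlySimpleRoots S.det)
    {P₀ P : Matrix (Fin m) (Fin m) (Polynomial ℂ)} (hP₀ : gram P₀ = S) (hP₀0 : P₀.det.coeff 0 ≠ 0)
    (hP : gram P = S) (hP0 : P.det.coeff 0 ≠ 0) {a : ℂ}
    (ha : a ∈ rootsIn P₀.det.roots.toFinset P) :
    ∃ Q : Matrix (Fin m) (Fin m) (Polynomial ℂ), gram Q = S ∧ Q.det.coeff 0 ≠ 0 ∧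
      rootsIn P₀.det.roots.toFinset Q = (rootsIn P₀.det.roots.toFinset P).erase a := by
  have hP₀ne : P₀.det ≠ 0 := by
    intro hz
    rw [hz] at hP₀0
    simp at hP₀0
  simp only [rootsIn, Finset.mem_filter, Multiset.mem_toFinset, Polynomial.mem_roots hP₀ne,
    Polynomial.IsRoot] at ha
  obtain ⟨ha₀, ha⟩ := ha
  have hane : a ≠ 0 := by
    rintro rfl
    rw [Polynomial.coeff_zero_eq_eval_zero] at hP0
    exact hP0 ha
  obtain ⟨Q, c, hc, hQ, hdet⟩ := exists_flip P a ha
  lift a to ℂˣ using isUnit_iff_ne_zero.mpr hane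
  rw [hP] at hQ
  have hev (b : ℂ) : Q.det.eval b * (b - a) = c * P.det.eval b * (1 - star (a : ℂ) * b) := by
    simpa using congrArg (Polynomial.eval b) hdet
  have hrefl {b : ℂ} (hb : 1 - star (a : ℂ) * b = 0) : b = (refl a : ℂ) := by
    rw [refl_coe]
    exact eq_inv_of_mul_eq_one_right (by linear_combination -hb)
  have hra : (1 : ℂ) - star (a : ℂ) * (refl a : ℂ) = 0 := by
    simp [refl_coe]
  refine ⟨Q, hQ, ?_, ?_⟩
  · rw [Polynomial.coeff_zero_eq_eval_zero] at hP0 ⊢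
    intro hz
    have := hev 0
    rw [hz, zero_mul, mul_zero, sub_zero, mul_one] at this
    exact mul_ne_zero hc hP0 this.symm
  · ext b
    simp only [rootsIn, Finset.mem_erase, Finset.mem_filter, Multiset.mem_toFinset,
      Polynomial.mem_roots hP₀ne, Polynomial.IsRoot]
    constructor
    · rintro ⟨hb₀, hb⟩
      have hba : b ≠ a := by
        rintro rfl
        have h1 := hev (refl a : ℂ)
        rw [hra, mul_zero] at h1
        rcases mul_eq_zero.mp h1 with h2 | h2
        · exact eval_det_refl_ne_zero hsimple hQ a hb h2
        · rw [sub_eq_zero] at h2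
          have h3 := eval_det_refl_ne_zero hsimple hP a ha
          rw [h2] at h3
          exact h3 ha
      refine ⟨hba, hb₀, ?_⟩
      have h1 := hev b
      rw [hb, zero_mul] at h1
      rcases mul_eq_zero.mp h1.symm with h2 | h2
      · exact (mul_eq_zero.mp h2).resolve_left hc
      -- The zero created by the flip lies at 1/conj a, which is not a zero of det P₀ and so does
      -- not enter the code.
      · rw [hrefl h2] at hb₀
        exact absurd hb₀ (eval_det_refl_ne_zero hsimple hP₀ a ha₀)
    · rintro ⟨hba, hb₀, hb⟩
      refine ⟨hb₀, ?_⟩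
      have h1 := hev b
      rw [hb, mul_zero, zero_mul] at h1
      exact (mul_eq_zero.mp h1).resolve_right (sub_ne_zero.mpr hba)

theorem exists_rootsIn_eq (hsimple : HasOnlySimpleRoots S.det)
    {P₀ : Matrix (Fin m) (Fin m) (Polynomial ℂ)} (hP₀ : gram P₀ = S) (hP₀0 : P₀.det.coeff 0 ≠ 0)
    {F : Finset ℂ} (hF : F ⊆ P₀.det.roots.toFinset) :
    ∃ Q : Matrix (Fin m) (Fin m) (Polynomial ℂ), gram Q = S ∧ Q.det.coeff 0 ≠ 0 ∧
      rootsIn P₀.det.roots.toFinset Q = P₀.det.roots.toFinset \ F := by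
  induction F using Finset.induction_on with
  | empty =>
    refine ⟨P₀, hP₀, hP₀0, ?_⟩
    rw [Finset.sdiff_empty, rootsIn, Finset.filter_true_of_mem]
    intro a ha
    exact Polynomial.isRoot_of_mem_roots (Multiset.mem_toFinset.mp ha)
  | insert a F haF ih =>
    obtain ⟨haR, hFR⟩ := Finset.insert_subset_iff.mp hF
    obtain ⟨P, hP, hP0, hPF⟩ := ih hFR
    obtain ⟨Q, hQ, hQ0, hQF⟩ := exists_rootsIn_eq_erase hsimple hP₀ hP₀0 hP hP0 (a := a) (by
      rw [hPF]
      exact Finset.mem_sdiff.mpr ⟨haR, haF⟩)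
    exact ⟨Q, hQ, hQ0, by rw [hQF, hPF, Finset.sdiff_insert]⟩

theorem exists_unitary_of_rootsIn_eq (hsimple : HasOnlySimpleRoots S.det)
    {P₀ P Q : Matrix (Fin m) (Fin m) (Polynomial ℂ)} (hP₀ : gram P₀ = S) (hP₀0 : P₀.det.coeff 0 ≠ 0)
    (hP : gram P = S) (hP0 : P.det.coeff 0 ≠ 0) (hQ : gram Q = S) (hQ0 : Q.det.coeff 0 ≠ 0)
    (h : rootsIn P₀.det.roots.toFinset P = rootsIn P₀.det.roots.toFinset Q) :
    ∃ W ∈ Matrix.unitaryGroup (Fin m) ℂ, P = Q * W.map Polynomial.C := by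
  have hP₀ne : P₀.det ≠ 0 := by
    intro hz
    rw [hz] at hP₀0
    simp at hP₀0
  have hmem (b : ℂ) (hb : P₀.det.eval b = 0) : P.det.eval b = 0 ↔ Q.det.eval b = 0 := by
    have := Finset.ext_iff.mp h b
    simpa [rootsIn, hP₀ne, hb] using this
  refine exists_unitary_of_roots (hP.trans hQ.symm) (by rwa [hQ]) hP0 hQ0 fun a ha hb => ?_
  -- A zero a of det Q is a zero of det S, so a or 1/conj a is a zero of det P₀; in either case
  -- agreement of the codes there excludes det P(1/conj a) = 0.
  have hz : ev a S.det = 0 := by rw [eval_det_mul_star hQ, ha, zero_mul]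
  rw [eval_det_mul_star hP₀] at hz
  rcases mul_eq_zero.mp hz with h1 | h1
  · exact eval_det_refl_ne_zero hsimple hP a ((hmem _ h1).mpr ha) hb
  · exact eval_det_refl_ne_zero hsimple hQ a ha ((hmem _ (star_eq_zero.mp h1)).mp hb)

theorem countUpToUnitary_eq (hpos : PosDefAE S) (hsimple : HasOnlySimpleRoots S.det)
    (hL : HasDegree S.det L) :
    countUpToUnitary {P | gram P = S ∧ P.det.coeff 0 ≠ 0} = 2 ^ L := by
  obtain ⟨P₁, hP₁⟩ := exists_gram_eq_of_posDefAE S hpos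
  have hdet₁ : P₁.det ≠ 0 := by
    intro hz
    have := det_gram P₁
    rw [hP₁, hz, map_zero, zero_mul] at this
    exact det_ne_zero_of_posDefAE hpos this
  -- A flip at the origin replaces a column factor z by 1, so zeros of the determinant at 0 can be
  -- removed.
  obtain ⟨P₀, hP₀, hP₀0⟩ := exists_eval_det_ne_zero 0 (by simp) P₁ hdet₁
  rw [hP₁] at hP₀
  rw [← Polynomial.coeff_zero_eq_eval_zero] at hP₀0
  have hp : P₀.det.toLaurent * adj P₀.det.toLaurent = S.det := by rw [← det_gram, hP₀]
  have hle := natDegree_le_of_coeff_zero_ne_zero hL hp hP₀0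
  have hdeg : P₀.det.natDegree = L :=
    le_antisymm hle (Polynomial.le_natDegree_of_ne_zero (coeff_zero_mul_coeff_ne_zero hL hp hle).2)
  have hcard : P₀.det.roots.toFinset.card = L := by
    rw [Multiset.toFinset_card_of_nodup (roots_nodup hsimple hp hP₀0),
      ← (IsAlgClosed.splits P₀.det).natDegree_eq_card_roots, hdeg]
  let Z : Quotient (unitarySetoid m) → Finset ℂ :=
    Quotient.lift (rootsIn P₀.det.roots.toFinset) (by
      rintro P Q ⟨U, hU, rfl⟩
      refine Finset.filter_congr fun a _ => ?_
      rw [det_mul_map_C, Polynomial.eval_mul, Polynomial.eval_C, mul_eq_zero,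
        or_iff_left (det_ne_zero_of_mem_unitaryGroup hU)])
  have hinj : Set.InjOn Z
      (Quotient.mk (unitarySetoid m) '' {P | gram P = S ∧ P.det.coeff 0 ≠ 0}) := by
    rintro _ ⟨P, ⟨hP, hP0⟩, rfl⟩ _ ⟨Q, ⟨hQ, hQ0⟩, rfl⟩ h
    exact Quotient.sound (exists_unitary_of_rootsIn_eq hsimple hP₀ hP₀0 hQ hQ0 hP hP0 h.symm)
  have himage : Z '' (Quotient.mk (unitarySetoid m) '' {P | gram P = S ∧ P.det.coeff 0 ≠ 0}) =
      (P₀.det.roots.toFinset.powerset : Set (Finset ℂ)) := by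
    ext F
    constructor
    · rintro ⟨_, ⟨P, -, rfl⟩, rfl⟩
      exact Finset.mem_coe.mpr (Finset.mem_powerset.mpr (Finset.filter_subset _ _))
    · intro hF
      have hF' := Finset.mem_powerset.mp (Finset.mem_coe.mp hF)
      -- To keep exactly the zeros in F, flip those in the complement.
      obtain ⟨Q, hQ, hQ0, hQF⟩ := exists_rootsIn_eq hsimple hP₀ hP₀0
        (Finset.sdiff_subset (s := P₀.det.roots.toFinset) (t := F))
      rw [Finset.sdiff_sdiff_eq_self hF'] at hQF
      exact ⟨_, ⟨Q, ⟨hQ, hQ0⟩, rfl⟩, hQF⟩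
  rw [countUpToUnitary, ← hinj.encard_image, himage, Set.encard_coe_eq_coe_finsetCard,
    Finset.card_powerset, hcard]
  norm_cast

end Count

end SpectralFactor

end

theorem corollary1 (m N L : ℕ) (S : Matrix (Fin m) (Fin m) (LaurentPolynomial ℂ))
    (hN : SpectralFactor.HasMatrixDegree S N)
    (hpos : SpectralFactor.PosDefAE S)
    (hsimple : SpectralFactor.HasOnlySimpleRoots S.det)
    (hL : SpectralFactor.HasDegree S.det L) :
    SpectralFactor.countUpToUnitary
        {P | SpectralFactor.IsSpectralFactor S N P ∧
          SpectralFactor.IsScalarSpectralFactor S.det L P.det} = 2 ^ L ∧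
      (L = m * N →
        SpectralFactor.countUpToUnitary {P | SpectralFactor.IsSpectralFactor S N P} = 2 ^ L) := by
  have hset : {P | SpectralFactor.IsSpectralFactor S N P ∧
      SpectralFactor.IsScalarSpectralFactor S.det L P.det} =
      {P | SpectralFactor.gram P = S ∧ P.det.coeff 0 ≠ 0} :=
    Set.ext fun P => SpectralFactor.isSpectralFactor_and_iff hN hL P
  have hcount := SpectralFactor.countUpToUnitary_eq hpos hsimple hL
  rw [← hset] at hcount
  refine ⟨hcount, fun hLN => ?_⟩
  convert hcount using 2
  ext P
  refine ⟨fun hP => ⟨hP, ?_, ?_⟩, fun hP => hP.1⟩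
  -- At full degree, det P has degree at most mN = L for every spectral factor P, so the determinant
  -- condition is automatic.
  · rw [hLN]
    exact SpectralFactor.natDegree_det_le hP.natDegree_le
  · rw [← SpectralFactor.det_gram, SpectralFactor.gram, hP.mul_adj]
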